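/- Let $U,Y,Z$ be random variables with values in finite sets $\mathcal U,\mathcal Y,\mathcal Z$ of cardinalities $K_U,K_Y,K_Z$. Suppose that $P(Y=y)\ge p_{\min}>0$ and $P(U=u,Z=z\mid Y=y)\ge q_{\min}>0$ for all $u,y,z$. For a probability mass function $p$ on $\mathcal U\times\mathcal Y\times\mathcal Z$ let $$I_p=\sum_{y}p(y)\sum_{u,z}p(u,z\mid y)\log\frac{p(u,z\mid y)}{p(u\mid y)\,p(z\mid y)}$$ (natural logarithm; $0\log 0=0$, and terms with $p(y)=0$ are $0$), and let $I(U;Z\mid Y)$ be the value of $I_p$ at the joint law of $(U,Y,Z)$. Given a batch $B$ of $|B|$ i.i.d. copies of $(U,Y,Z)$, let $\widehat I_B$ be the plug-in estimator, that is, the value of $I_p$ at the empirical distribution (relative frequencies) of the batch. 1. (Asymptotic bias.) There is a constant $A=A(K_U,K_Y,K_Z,p_{\min},q_{\min})$ such that for all $|B|\ge 1$ $$\left|\mathbb E[\widehat I_B]-I(U;Z\mid Y)-\frac{K_Y(K_U-1)(K_Z-1)}{2|B|}\right|\le\frac{A}{|B|^{2}}.$$ In particular, if $K_U,K_Z\ge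 2$, the bias is strictly positive for all $|B|\ge N_1$, where $N_1=N_1(K_U,K_Y,K_Z,p_{\min},q_{\min})$. 2. (Concentration.) There is a constant $C=C(K_U,K_Y,K_Z,p_{\min},q_{\min})$ such that for every $\delta\in(0,1)$ there is $N_2=N_2(\delta,K_U,K_Y,K_Z,p_{\min},q_{\min})$ such that, for all $|B|\ge N_2$, with probability at least $1-\delta$, $$\left|\widehat I_B-\mathbb E[\widehat I_B]\right|\le C\sqrt{\frac{\log(2/\delta)}{|B|}}.$$ -/

import Mathlib

open MeasureTheory ProbabilityTheory

noncomputable section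

/-! Notions for three random variables `U`, `Y`, `Z` with values in finite sets. A joint
distribution is given by its mass function `p u y z`. -/

/-- The marginal mass `p(y)`. -/
def massY {𝒰 𝒴 𝒵 : Type*} [Fintype 𝒰] [Fintype 𝒵] (p : 𝒰 → 𝒴 → 𝒵 → ℝ) (y : 𝒴) : ℝ :=
  ∑ u, ∑ z, p u y z

/-- The conditional mass `p(u, z | y)` (equal to `0` if `p(y) = 0`). -/
def condMassUZ {𝒰 𝒴 𝒵 : Type*} [Fintype 𝒰] [Fintype 𝒵] (p : 𝒰 → 𝒴 → 𝒵 → ℝ)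
    (y : 𝒴) (u : 𝒰) (z : 𝒵) : ℝ :=
  p u y z / massY p y

/-- The conditional mass `p(u | y)`. -/
def condMassU {𝒰 𝒴 𝒵 : Type*} [Fintype 𝒰] [Fintype 𝒵] (p : 𝒰 → 𝒴 → 𝒵 → ℝ)
    (y : 𝒴) (u : 𝒰) : ℝ :=
  ∑ z, condMassUZ p y u z

/-- The conditional mass `p(z | y)`. -/
def condMassZ {𝒰 𝒴 𝒵 : Type*} [Fintype 𝒰] [Fintype 𝒵] (p : 𝒰 → 𝒴 → 𝒵 → ℝ)
    (y : 𝒴) (z : 𝒵) : ℝ :=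
  ∑ u, condMassUZ p y u z

/-- Conditional mutual information `I(U; Z | Y)` (in nats) of the mass function `p`:
`∑_y p(y) ∑_{u,z} p(u,z|y) log (p(u,z|y) / (p(u|y) p(z|y)))`.
Summands with `p(y) = 0` or `p(u,z|y) = 0` vanish (usual convention `0 log 0 = 0`). -/
def condMutualInfo {𝒰 𝒴 𝒵 : Type*} [Fintype 𝒰] [Fintype 𝒴] [Fintype 𝒵]
    (p : 𝒰 → 𝒴 → 𝒵 → ℝ) : ℝ :=
  ∑ y, massY p y * ∑ u, ∑ z, condMassUZ p y u z *
    Real.log (condMassUZ p y u z / (condMassU p y u * condMassZ p y z))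

/-- The joint mass function of the random variables `U`, `Y`, `Z` under `P`. -/
def jointMass {Ω 𝒰 𝒴 𝒵 : Type*} [MeasurableSpace Ω] (P : Measure Ω)
    (U : Ω → 𝒰) (Y : Ω → 𝒴) (Z : Ω → 𝒵) (u : 𝒰) (y : 𝒴) (z : 𝒵) : ℝ :=
  P.real {ω | U ω = u ∧ Y ω = y ∧ Z ω = z}

open Classical in
/-- The empirical mass function (relative frequencies) of a data set `s` of `n` triples. -/
def empiricalMass {𝒰 𝒴 𝒵 : Type*} {n : ℕ} (s : Fin n → 𝒰 × 𝒴 × 𝒵)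
    (u : 𝒰) (y : 𝒴) (z : 𝒵) : ℝ :=
  ((Finset.univ.filter fun i => s i = (u, y, z)).card : ℝ) / (n : ℝ)

/-- The plug-in (sample) estimator of `I(U; Z | Y)`: the conditional mutual information of the
empirical distribution of the data set. -/
def sampleCMI {𝒰 𝒴 𝒵 : Type*} [Fintype 𝒰] [Fintype 𝒴] [Fintype 𝒵] {n : ℕ}
    (s : Fin n → 𝒰 × 𝒴 × 𝒵) : ℝ :=
  condMutualInfo (empiricalMass s)

end

/-! Conditional mutual information is a signed sum of `x log x` over the cells of four marginals:
`+` for `(U, Y, Z)` and `Y`, `-` for `(U, Y)` and `(Y, Z)` (`condMutualInfo_eq_sum`). The plug-in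
estimator is the same sum at relative frequencies, and each frequency `f` is a mean of i.i.d.
Bernoulli variables whose parameter `p` is at least `r = pmin * qmin`. Only one cell at a time has
to be understood; dependence between cells plays no role.

Bias: expand `x log x` at `p` to third order, with a quartic remainder valid for all `x ≥ 0`, so
that empty cells need no separate treatment. The second moment contributes `(1 - p) / (2n)`; the
third and fourth are `O(n⁻²)`. In the signed sum of `1 - p` the masses cancel, and the signed number
of cells is `KY (KU - 1) (KZ - 1)`.

Concentration: `x log x` is Lipschitz around each `p ≥ r`, so Hoeffding and a union bound control
the distance to the population value, and the bias estimate allows replacing that value by the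
expectation. -/

/-! ### Global Taylor and Lipschitz bounds for `x log x`. -/

/-- The derivative has the sign of `t - 1`, so `f` decreases up to `1` and increases afterwards. -/
theorem le_of_hasDerivAt_sign {f f' : ℝ → ℝ} (hf : ∀ t, 0 < t → HasDerivAt f (f' t) t)
    (hs : ∀ t, 0 < t → 0 ≤ (t - 1) * f' t) {t : ℝ} (ht : 0 < t) : f 1 ≤ f t := by
  rcases le_total t 1 with h | h
  · have hanti : AntitoneOn f (Set.Icc t 1) := by
      refine antitoneOn_of_deriv_nonpos (convex_Icc t 1) ?_ ?_ ?_
      · exact fun x hx => (hf x (ht.trans_le hx.1)).continuousAt.continuousWithinAt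
      · intro x hx
        rw [interior_Icc] at hx
        exact (hf x (ht.trans hx.1)).differentiableAt.differentiableWithinAt
      · intro x hx
        rw [interior_Icc] at hx
        rw [(hf x (ht.trans hx.1)).deriv]
        have := hs x (ht.trans hx.1)
        by_contra! hc
        nlinarith [hx.2]
    exact hanti ⟨le_rfl, h⟩ ⟨h, le_rfl⟩ h
  · have hmono : MonotoneOn f (Set.Icc 1 t) := by
      refine monotoneOn_of_deriv_nonneg (convex_Icc 1 t) ?_ ?_ ?_
      · exact fun x hx =>
          (hf x (one_pos.trans_le hx.1)).continuousAt.continuousWithinAt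
      · intro x hx
        rw [interior_Icc] at hx
        exact (hf x (one_pos.trans hx.1)).differentiableAt.differentiableWithinAt
      · intro x hx
        rw [interior_Icc] at hx
        rw [(hf x (one_pos.trans hx.1)).deriv]
        have := hs x (one_pos.trans hx.1)
        by_contra! hc
        nlinarith [hx.1]
    exact hmono ⟨le_rfl, h⟩ ⟨h, le_rfl⟩ h

theorem log_le_cubic {t : ℝ} (ht : 0 < t) :
    Real.log t ≤ (t - 1) - (t - 1) ^ 2 / 2 + (t - 1) ^ 3 / 3 := by
  have key := le_of_hasDerivAt_sign
    (f := fun t => (t - 1) - (t - 1) ^ 2 / 2 + (t - 1) ^ 3 / 3 - Real.log t)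
    (f' := fun t => 1 - (t - 1) + (t - 1) ^ 2 - t⁻¹) ?_ ?_ ht
  · norm_num at key
    linarith
  · intro t ht
    have h1 : HasDerivAt (fun t : ℝ => t - 1) 1 t := (hasDerivAt_id t).sub_const 1
    refine (((h1.sub ((h1.pow 2).div_const 2)).add ((h1.pow 3).div_const 3)).sub
      (Real.hasDerivAt_log ht.ne')).congr_deriv ?_
    norm_num
  · intro t ht
    have : (t - 1) * (1 - (t - 1) + (t - 1) ^ 2 - t⁻¹) = (t - 1) ^ 4 / t := by
      field_simp
      ring
    rw [this]
    positivity

/-- The left side is the cubic Taylor polynomial of `t log t` at `1`, divided by `t`. -/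
theorem le_log_of_quadratic {t : ℝ} (ht : 0 < t) :
    -1 / 2 + t - t ^ 2 / 6 - t⁻¹ / 3 ≤ Real.log t := by
  have key := le_of_hasDerivAt_sign
    (f := fun t => Real.log t - (-1 / 2 + t - t ^ 2 / 6 - t⁻¹ / 3))
    (f' := fun t => t⁻¹ - (1 - 2 * t / 6 - (-(t ^ 2)⁻¹) / 3)) ?_ ?_ ht
  · norm_num at key
    linarith
  · intro t ht
    have h1 : HasDerivAt (fun t : ℝ => t) 1 t := hasDerivAt_id t
    refine ((Real.hasDerivAt_log ht.ne').sub (((h1.const_add (-1 / 2)).sub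
      ((h1.pow 2).div_const 6)).sub ((hasDerivAt_inv ht.ne').div_const 3))).congr_deriv ?_
    norm_num
  · intro t ht
    have : (t - 1) * (t⁻¹ - (1 - 2 * t / 6 - (-(t ^ 2)⁻¹) / 3)) = (t - 1) ^ 4 / (3 * t ^ 2) := by
      field_simp
      ring
    rw [this]
    positivity

/-- Multiply the two logarithm bounds by `t`: the lower one gives the Taylor polynomial exactly, the
upper one exceeds it by exactly `(t - 1) ^ 4 / 3`. -/
theorem abs_mul_log_sub_taylor_le_at_one {t : ℝ} (ht : 0 ≤ t) :
    |t * Real.log t - ((t - 1) + (t - 1) ^ 2 / 2 - (t - 1) ^ 3 / 6)| ≤ (t - 1) ^ 4 / 3 := by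
  rcases ht.eq_or_lt with rfl | ht
  · norm_num
  · have h1 := mul_le_mul_of_nonneg_left (log_le_cubic ht) ht.le
    have h2 := mul_le_mul_of_nonneg_left (le_log_of_quadratic ht) ht.le
    have h3 : t * (-1 / 2 + t - t ^ 2 / 6 - t⁻¹ / 3)
        = (t - 1) + (t - 1) ^ 2 / 2 - (t - 1) ^ 3 / 6 := by
      field_simp
      ring
    have h4 : 0 ≤ (t - 1) ^ 4 := by positivity
    rw [abs_le]
    constructor <;> nlinarith

/-- Third order Taylor expansion of `x ↦ x log x` at `p`, valid on the whole half line. -/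
theorem abs_mul_log_sub_taylor_le {p x : ℝ} (hp : 0 < p) (hx : 0 ≤ x) :
    |x * Real.log x - (p * Real.log p + (Real.log p + 1) * (x - p) + (x - p) ^ 2 / (2 * p)
      - (x - p) ^ 3 / (6 * p ^ 2))| ≤ (x - p) ^ 4 / (3 * p ^ 3) := by
  obtain ⟨t, ht, rfl⟩ : ∃ t, 0 ≤ t ∧ x = p * t :=
    ⟨x / p, by positivity, by field_simp⟩
  have h := mul_le_mul_of_nonneg_left (abs_mul_log_sub_taylor_le_at_one ht) hp.le
  rw [← abs_of_pos hp, ← abs_mul, abs_of_pos hp] at h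
  have hlog : p * t * Real.log (p * t) = p * t * Real.log p + p * (t * Real.log t) := by
    rcases ht.eq_or_lt with rfl | ht
    · simp
    · rw [Real.log_mul hp.ne' ht.ne']
      ring
  rw [hlog]
  have h2 : (p * t - p) ^ 2 / (2 * p) = p * ((t - 1) ^ 2 / 2) := by field_simp
  have h3 : (p * t - p) ^ 3 / (6 * p ^ 2) = p * ((t - 1) ^ 3 / 6) := by field_simp
  have h4 : (p * t - p) ^ 4 / (3 * p ^ 3) = p * ((t - 1) ^ 4 / 3) := by field_simp
  rw [h2, h3, h4]
  refine le_of_eq_of_le (congrArg _ ?_) h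
  ring

/-- `x ↦ x log x` satisfies a Lipschitz bound at each base point in `[r, 1]`. -/
theorem abs_mul_log_sub_mul_log_le {r p x : ℝ} (hr : 0 < r) (hrp : r ≤ p) (hp1 : p ≤ 1)
    (hx : 0 ≤ x) (hx1 : x ≤ 1) :
    |x * Real.log x - p * Real.log p| ≤ (1 / r - Real.log r) * |x - p| := by
  have hp := hr.trans_le hrp
  have hr1 : 1 ≤ 1 / r := by rw [le_div_iff₀ hr]; linarith
  have hlp : |Real.log p| ≤ -Real.log r := by
    rw [abs_of_nonpos (Real.log_nonpos hp.le hp1)]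
    linarith [Real.log_le_log hr hrp]
  obtain ⟨t, ht, rfl⟩ : ∃ t, 0 ≤ t ∧ x = p * t :=
    ⟨x / p, by positivity, by field_simp⟩
  have htr : t ≤ 1 / r := by
    rw [le_div_iff₀ hr]
    nlinarith
  have hlog : p * t * Real.log (p * t) - p * Real.log p
      = p * (t * Real.log t) + Real.log p * (p * t - p) := by
    rcases ht.eq_or_lt with rfl | ht
    · simp; ring
    · rw [Real.log_mul hp.ne' ht.ne']
      ring
  -- From `t - 1 ≤ t log t ≤ t (t - 1)`, with both `1` and `t` at most `1 / r`.
  have hmain : |t * Real.log t| ≤ 1 / r * |t - 1| := by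
    rcases ht.eq_or_lt with rfl | ht
    · simp; positivity
    have h1 := mul_le_mul_of_nonneg_left (Real.log_le_sub_one_of_pos ht) ht.le
    have h2 : t - 1 ≤ t * Real.log t := by
      have := mul_le_mul_of_nonneg_left (Real.one_sub_inv_le_log_of_pos ht) ht.le
      rwa [mul_sub, mul_inv_cancel₀ ht.ne', mul_one] at this
    rcases le_total t 1 with h | h
    · rw [abs_of_nonpos (sub_nonpos.2 h), abs_of_nonpos (by nlinarith)]
      nlinarith
    · rw [abs_of_nonneg (sub_nonneg.2 h), abs_of_nonneg (by linarith)]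
      nlinarith
  calc |p * t * Real.log (p * t) - p * Real.log p|
      ≤ |p * (t * Real.log t)| + |Real.log p * (p * t - p)| := by
        rw [hlog]; exact abs_add_le _ _
    _ = p * |t * Real.log t| + |Real.log p| * |p * t - p| := by
        rw [abs_mul p, abs_mul (Real.log p), abs_of_pos hp]
    _ ≤ p * (1 / r * |t - 1|) + -Real.log r * |p * t - p| := by gcongr
    _ = (1 / r - Real.log r) * |p * t - p| := by
        have : |p * t - p| = p * |t - 1| := by
          rw [← abs_of_pos hp, ← abs_mul, abs_of_pos hp]; congr 1; ring
        rw [this]; ring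

/-! ### Moments of sums of independent variables. -/

/-- The first four moments of a sum of independent centred random variables bounded by `1`
with common second and third moments. -/
theorem moments_sum_of_iIndepFun {ι Ω : Type*} [MeasurableSpace Ω] {μ : Measure Ω}
    [IsProbabilityMeasure μ] {X : ι → Ω → ℝ} {v w : ℝ} (hX : iIndepFun X μ)
    (hm : ∀ i, AEMeasurable (X i) μ) (hb : ∀ i ω, |X i ω| ≤ 1) (h1 : ∀ i, ∫ ω, X i ω ∂μ = 0)
    (h2 : ∀ i, ∫ ω, X i ω ^ 2 ∂μ = v) (h3 : ∀ i, ∫ ω, X i ω ^ 3 ∂μ = w) (s : Finset ι) :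
    ∫ ω, (∑ i ∈ s, X i ω) ∂μ = 0 ∧ ∫ ω, (∑ i ∈ s, X i ω) ^ 2 ∂μ = s.card * v ∧
      ∫ ω, (∑ i ∈ s, X i ω) ^ 3 ∂μ = s.card * w ∧
      ∫ ω, (∑ i ∈ s, X i ω) ^ 4 ∂μ ≤ 3 * (s.card : ℝ) ^ 2 := by
  classical
  induction s using Finset.induction_on with
  | empty => simp
  | insert j s hj ih =>
    obtain ⟨i1, i2, i3, i4⟩ := ih
    set T : Ω → ℝ := fun ω => ∑ i ∈ s, X i ω with hT
    change ∫ ω, T ω ^ 2 ∂μ = _ at i2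
    change ∫ ω, T ω ^ 3 ∂μ = _ at i3
    change ∫ ω, T ω ^ 4 ∂μ ≤ _ at i4
    have hTm : AEMeasurable T μ := Finset.aemeasurable_fun_sum s fun i _ => hm i
    have hTb : ∀ ω, |T ω| ≤ s.card := fun ω =>
      (Finset.abs_sum_le_sum_abs _ _).trans
        ((Finset.sum_le_card_nsmul _ _ 1 fun i _ => hb i ω).trans (by simp))
    have hind : IndepFun T (X j) μ := by
      have := hX.indepFun_finsetSum_of_notMem₀ hm hj
      convert! this using 1
      ext ω
      simp [hT]
    have hint : ∀ a b : ℕ, Integrable (fun ω => T ω ^ a * X j ω ^ b) μ := fun a b => by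
      refine Integrable.of_bound ((hTm.pow_const a).mul
        ((hm j).pow_const b)).aestronglyMeasurable ((s.card : ℝ) ^ a) (ae_of_all _ fun ω => ?_)
      rw [Real.norm_eq_abs, abs_mul, abs_pow, abs_pow, ← mul_one ((s.card : ℝ) ^ a)]
      exact mul_le_mul (pow_le_pow_left₀ (abs_nonneg _) (hTb ω) _)
        (pow_le_one₀ (abs_nonneg _) (hb j ω)) (by positivity) (by positivity)
    have hprod : ∀ a b : ℕ, ∫ ω, T ω ^ a * X j ω ^ b ∂μ
        = (∫ ω, T ω ^ a ∂μ) * ∫ ω, X j ω ^ b ∂μ := fun a b =>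
      (hind.comp (measurable_id.pow_const a) (measurable_id.pow_const b)
        ).integral_fun_mul_eq_mul_integral (hTm.pow_const a).aestronglyMeasurable
          ((hm j).pow_const b).aestronglyMeasurable
    have hv : 0 ≤ v := by
      rw [← h2 j]
      exact integral_nonneg fun ω => by positivity
    have hle : ∀ k : ℕ, ∫ ω, X j ω ^ k ∂μ ≤ 1 := fun k => by
      calc ∫ ω, X j ω ^ k ∂μ ≤ ∫ _ω, (1 : ℝ) ∂μ := by
            refine integral_mono (by simpa using hint 0 k) (integrable_const _) fun ω => ?_
            refine (le_abs_self _).trans ?_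
            rw [abs_pow]
            exact pow_le_one₀ (abs_nonneg _) (hb j ω)
        _ = 1 := by simp
    have hv1 : v ≤ 1 := h2 j ▸ hle 2
    have hc : ((insert j s).card : ℝ) = s.card + 1 := by
      rw [Finset.card_insert_of_notMem hj]; push_cast; rfl
    have hs : ∀ ω, ∑ i ∈ insert j s, X i ω = T ω + X j ω := fun ω => by
      rw [Finset.sum_insert hj, add_comm]
    simp_rw [hs, hc]
    have hpow : ∀ m : ℕ, ∫ ω, (T ω + X j ω) ^ m ∂μ = ∑ k ∈ Finset.range (m + 1),
        (∫ ω, T ω ^ k ∂μ) * (∫ ω, X j ω ^ (m - k) ∂μ) * (m.choose k : ℝ) := fun m => by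
      simp_rw [add_pow]
      rw [integral_finsetSum _ fun k _ => (hint k (m - k)).mul_const _]
      simp_rw [integral_mul_const, hprod]
    have hch : Nat.choose 4 2 = 6 := rfl
    refine ⟨?_, ?_, ?_, ?_⟩
    · have := hpow 1
      simpa [Finset.sum_range_succ, i1, h1] using this
    · rw [hpow]
      simp [Finset.sum_range_succ, i1, i2, h1, h2]
      ring
    · rw [hpow]
      simp [Finset.sum_range_succ, i1, i2, i3, h1, h2, h3]
      ring
    · rw [hpow]
      simp [Finset.sum_range_succ, i1, i2, i3, h1, h2, h3, hch]
      -- With `k = s.card`, the odd cross terms vanish and the fourth moment is at most `3k² + 6k v²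
      -- + 1 ≤ 3(k + 1)²`.
      have hvv : v * v ≤ 1 := by nlinarith
      have : (s.card : ℝ) * (v * v) ≤ s.card * 1 := by gcongr
      nlinarith [hle 4]

/-! ### A single cell: means of Bernoulli variables. -/

theorem mean_mem_Icc_of_bernoulli {Ω : Type*} {n : ℕ} {b : Fin n → Ω → ℝ}
    (hb : ∀ i ω, b i ω = 0 ∨ b i ω = 1) (ω : Ω) :
    (∑ i, b i ω) / n ∈ Set.Icc (0 : ℝ) 1 := by
  have h0 : ∀ i, 0 ≤ b i ω := fun i => by rcases hb i ω with h | h <;> simp [h]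
  have h1 : ∀ i, b i ω ≤ 1 := fun i => by rcases hb i ω with h | h <;> simp [h]
  have hle : ∑ i, b i ω ≤ n := by
    simpa using Finset.sum_le_card_nsmul Finset.univ (fun i => b i ω) 1 fun i _ => h1 i
  exact ⟨div_nonneg (Finset.sum_nonneg fun i _ => h0 i) n.cast_nonneg,
    div_le_one_of_le₀ hle n.cast_nonneg⟩

theorem abs_mul_log_le_one {x : ℝ} (hx : x ∈ Set.Icc (0 : ℝ) 1) : |x * Real.log x| ≤ 1 := by
  rcases hx.1.eq_or_lt with rfl | h
  · simp
  · have h1 := mul_le_mul_of_nonneg_left (Real.one_sub_inv_le_log_of_pos h) h.le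
    rw [mul_sub, mul_inv_cancel₀ h.ne', mul_one] at h1
    have h2 := mul_nonneg h.le (neg_nonneg.2 (Real.log_nonpos h.le hx.2))
    rw [abs_le]
    constructor <;> linarith

theorem aemeasurable_mean {Ω : Type*} [MeasurableSpace Ω] {μ : Measure Ω} {n : ℕ}
    {b : Fin n → Ω → ℝ} (hm : ∀ i, AEMeasurable (b i) μ) :
    AEMeasurable (fun ω => (∑ i, b i ω) / (n : ℝ)) μ :=
  (Finset.aemeasurable_fun_sum Finset.univ fun i _ => hm i).div_const _

section Bernoulli

variable {Ω : Type*} [MeasurableSpace Ω] {μ : Measure Ω} [IsProbabilityMeasure μ] {n : ℕ}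
  {b : Fin n → Ω → ℝ} {p : ℝ}

theorem integrable_mean_mul_log (hm : ∀ i, AEMeasurable (b i) μ)
    (hb : ∀ i ω, b i ω = 0 ∨ b i ω = 1) :
    Integrable (fun ω => (∑ i, b i ω) / (n : ℝ) * Real.log ((∑ i, b i ω) / n)) μ :=
  Integrable.of_bound
    (Real.continuous_mul_log.measurable.comp_aemeasurable (aemeasurable_mean hm)).aestronglyMeasurable
    1 (ae_of_all _ fun ω => abs_mul_log_le_one (mean_mem_Icc_of_bernoulli hb ω))

/-- Any function of a `0`-`1` variable is affine in it, so the mean determines all moments. -/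
theorem integral_bernoulli_sub_pow (i : Fin n) (hm : ∀ i, AEMeasurable (b i) μ)
    (hb : ∀ i ω, b i ω = 0 ∨ b i ω = 1) (hp : ∀ i, ∫ ω, b i ω ∂μ = p) (k : ℕ) :
    ∫ ω, (b i ω - p) ^ k ∂μ = ((1 - p) ^ k - (-p) ^ k) * p + (-p) ^ k := by
  have hint : Integrable (b i) μ := Integrable.of_bound (hm i).aestronglyMeasurable 1
    (ae_of_all _ fun ω => by rcases hb i ω with h | h <;> simp [h])
  have : ∀ ω, (b i ω - p) ^ k = ((1 - p) ^ k - (-p) ^ k) * b i ω + (-p) ^ k := fun ω => by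
    rcases hb i ω with h | h <;> simp [h]
  simp_rw [this]
  rw [integral_add (hint.const_mul _) (integrable_const _), integral_const_mul, hp]
  simp

/-- The cubic term must be kept: its expectation is `O(n⁻²)` by centring, whereas an absolute cubic
remainder would in general only give `n ^ (-3/2)`. -/
theorem abs_integral_mean_mul_log_sub_le {r : ℝ} (hr : 0 < r) (hrp : r ≤ p) (hp1 : p ≤ 1)
    (hind : iIndepFun b μ) (hm : ∀ i, AEMeasurable (b i) μ)
    (hb : ∀ i ω, b i ω = 0 ∨ b i ω = 1) (hp : ∀ i, ∫ ω, b i ω ∂μ = p) (hn : 1 ≤ n) :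
    |(∫ ω, (∑ i, b i ω) / (n : ℝ) * Real.log ((∑ i, b i ω) / n) ∂μ) - p * Real.log p
      - (1 - p) / (2 * n)| ≤ (1 / r + 1 / r ^ 3) / (n : ℝ) ^ 2 := by
  have hp0 := hr.trans_le hrp
  have hn0 : (0 : ℝ) < n := by exact_mod_cast hn
  have hpow := fun i => integral_bernoulli_sub_pow i hm hb hp
  obtain ⟨m1, m2, m3, m4⟩ := moments_sum_of_iIndepFun (X := fun i ω => b i ω - p)
    (v := p * (1 - p)) (w := p * (1 - p) * (1 - 2 * p))
    (hind.comp (fun _ x => x - p) fun _ => measurable_id.sub_const p)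
    (fun i => (hm i).sub_const p)
    (fun i ω => by
      rw [abs_le]
      rcases hb i ω with h | h <;> rw [h] <;> constructor <;> linarith)
    (fun i => by simpa using hpow i 1) (fun i => by rw [hpow]; ring)
    (fun i => by rw [hpow]; ring) Finset.univ
  set f : Ω → ℝ := fun ω => (∑ i, b i ω) / (n : ℝ) with hf
  have hfI : ∀ ω, f ω ∈ Set.Icc (0 : ℝ) 1 := mean_mem_Icc_of_bernoulli hb
  have hfp : ∀ ω, ∑ i, (b i ω - p) = n * (f ω - p) := fun ω => by
    simp only [hf, Finset.sum_sub_distrib, Finset.sum_const, Finset.card_univ, Fintype.card_fin,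
      nsmul_eq_mul]
    field_simp
  simp only [hfp, mul_pow, integral_const_mul, Finset.card_univ, Fintype.card_fin] at m1 m2 m3 m4
  have k1 : ∫ ω, (f ω - p) ∂μ = 0 := by simpa [hn0.ne'] using m1
  have k2 : ∫ ω, (f ω - p) ^ 2 ∂μ = p * (1 - p) / n := by
    field_simp
    apply mul_left_cancel₀ hn0.ne'
    linear_combination m2
  have k3 : ∫ ω, (f ω - p) ^ 3 ∂μ = p * (1 - p) * (1 - 2 * p) / n ^ 2 := by
    field_simp
    apply mul_left_cancel₀ hn0.ne'
    linear_combination m3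
  have k4 : ∫ ω, (f ω - p) ^ 4 ∂μ ≤ 3 / n ^ 2 := by
    rw [le_div_iff₀ (by positivity)]
    refine le_of_mul_le_mul_left ?_ (show (0 : ℝ) < n ^ 2 by positivity)
    linear_combination m4
  have hint : ∀ k : ℕ, Integrable (fun ω => (f ω - p) ^ k) μ := fun k => by
    refine Integrable.of_bound
      (((aemeasurable_mean hm).sub_const p).pow_const k).aestronglyMeasurable 1
      (ae_of_all _ fun ω => ?_)
    rw [Real.norm_eq_abs, abs_pow]
    refine pow_le_one₀ (abs_nonneg _) ?_
    rw [abs_le]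
    constructor <;> linarith [(hfI ω).1, (hfI ω).2]
  have hlin : Integrable (fun ω => f ω - p) μ := by simpa using hint 1
  have hφ := integrable_mean_mul_log hm hb
  have i1 : Integrable (fun ω => p * Real.log p + (Real.log p + 1) * (f ω - p)) μ :=
    (integrable_const _).add (hlin.const_mul _)
  have i2 : Integrable (fun ω => p * Real.log p + (Real.log p + 1) * (f ω - p)
      + (f ω - p) ^ 2 / (2 * p)) μ := i1.add ((hint 2).div_const _)
  have i3 : Integrable (fun ω => p * Real.log p + (Real.log p + 1) * (f ω - p)
      + (f ω - p) ^ 2 / (2 * p) - (f ω - p) ^ 3 / (6 * p ^ 2)) μ := i2.sub ((hint 3).div_const _)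
  have hT : ∫ ω, (p * Real.log p + (Real.log p + 1) * (f ω - p) + (f ω - p) ^ 2 / (2 * p)
      - (f ω - p) ^ 3 / (6 * p ^ 2)) ∂μ
      = p * Real.log p + (1 - p) / (2 * n) - (1 - p) * (1 - 2 * p) / (6 * p * n ^ 2) := by
    rw [integral_sub i2 ((hint 3).div_const _), integral_add i1 ((hint 2).div_const _),
      integral_add (integrable_const _) (hlin.const_mul _), integral_const_mul (Real.log p + 1),
      integral_div, integral_div, k1, k2, k3]
    simp only [integral_const, probReal_univ, smul_eq_mul]
    field_simp
    ring
  have hR : |(∫ ω, f ω * Real.log (f ω) ∂μ) - ∫ ω, (p * Real.log p + (Real.log p + 1) * (f ω - p)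
      + (f ω - p) ^ 2 / (2 * p) - (f ω - p) ^ 3 / (6 * p ^ 2)) ∂μ| ≤ 1 / p ^ 3 / n ^ 2 := by
    rw [← integral_sub hφ i3]
    refine (abs_integral_le_integral_abs).trans ?_
    calc _ ≤ ∫ ω, (f ω - p) ^ 4 / (3 * p ^ 3) ∂μ :=
          integral_mono (hφ.sub i3).abs ((hint 4).div_const _) fun ω =>
            abs_mul_log_sub_taylor_le hp0 (hfI ω).1
      _ ≤ 3 / n ^ 2 / (3 * p ^ 3) := by
          rw [integral_div]
          gcongr
      _ = 1 / p ^ 3 / n ^ 2 := by field_simp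
  rw [hT] at hR
  have hw : |(1 - p) * (1 - 2 * p) / (6 * p * n ^ 2)| ≤ 1 / p / n ^ 2 := by
    rw [abs_div, abs_of_pos (show 0 < 6 * p * (n : ℝ) ^ 2 by positivity), div_div]
    refine div_le_div₀ zero_le_one ?_ (by positivity) (by nlinarith [sq_nonneg (n : ℝ)])
    rw [abs_le]
    constructor <;> nlinarith
  have hr1 : 1 / p ≤ 1 / r := one_div_le_one_div_of_le hr hrp
  have hr3 : 1 / p ^ 3 ≤ 1 / r ^ 3 := by gcongr
  calc _ = |((∫ ω, f ω * Real.log (f ω) ∂μ) - (p * Real.log p + (1 - p) / (2 * n)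
          - (1 - p) * (1 - 2 * p) / (6 * p * n ^ 2)))
          - (1 - p) * (1 - 2 * p) / (6 * p * n ^ 2)| := by congr 1; ring
    _ ≤ 1 / p ^ 3 / n ^ 2 + 1 / p / n ^ 2 := (abs_sub _ _).trans (add_le_add hR hw)
    _ = (1 / p + 1 / p ^ 3) / n ^ 2 := by ring
    _ ≤ _ := by gcongr

/-- Two-sided Hoeffding inequality for the mean of independent Bernoulli variables. -/
theorem measureReal_le_abs_mean_sub_le (hind : iIndepFun b μ) (hm : ∀ i, AEMeasurable (b i) μ)
    (hb : ∀ i ω, b i ω = 0 ∨ b i ω = 1) (hp : ∀ i, ∫ ω, b i ω ∂μ = p) (hn : 1 ≤ n)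
    {ε : ℝ} (hε : 0 ≤ ε) :
    μ.real {ω | ε ≤ |(∑ i, b i ω) / (n : ℝ) - p|} ≤ 2 * Real.exp (-(2 * n * ε ^ 2)) := by
  have hn0 : (0 : ℝ) < n := by exact_mod_cast hn
  have hsub : ∀ i ∈ Finset.univ, HasSubgaussianMGF (fun ω => b i ω - p)
      ((‖(1 : ℝ) - 0‖₊ / 2) ^ 2) μ := fun i _ => by
    have := hasSubgaussianMGF_of_mem_Icc (μ := μ) (X := b i) (a := 0) (b := 1) (hm i)
      (ae_of_all _ fun ω => by rcases hb i ω with h | h <;> simp [h])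
    rwa [hp i] at this
  have hi : iIndepFun (fun i ω => b i ω - p) μ :=
    hind.comp (fun _ x => x - p) fun _ => measurable_id.sub_const p
  -- The lower tail is the upper tail of the negated variables.
  have hi' : iIndepFun (fun i => -(fun ω => b i ω - p)) μ :=
    hi.comp (fun _ x => -x) fun _ => measurable_id.neg
  have e1 := HasSubgaussianMGF.measure_sum_ge_le_of_iIndepFun hi hsub
    (show 0 ≤ n * ε by positivity)
  have e2 := HasSubgaussianMGF.measure_sum_ge_le_of_iIndepFun hi'
    (fun i hi => (hsub i hi).neg) (show 0 ≤ n * ε by positivity)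
  have hexp : -((n : ℝ) * ε) ^ 2 / (2 * ((∑ _i : Fin n, (‖(1 : ℝ) - 0‖₊ / 2) ^ 2 : NNReal) : ℝ))
      = -(2 * n * ε ^ 2) := by
    simp
    field_simp
  rw [hexp] at e1 e2
  have hfp : ∀ ω, ∑ i, (b i ω - p) = n * ((∑ i, b i ω) / n - p) := fun ω => by
    simp only [Finset.sum_sub_distrib, Finset.sum_const, Finset.card_univ, Fintype.card_fin,
      nsmul_eq_mul]
    field_simp
  calc _ ≤ μ.real ({ω | n * ε ≤ ∑ i, (b i ω - p)} ∪
        {ω | n * ε ≤ ∑ i, (-(fun ω => b i ω - p)) ω}) := by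
        refine measureReal_mono fun ω hω => ?_
        simp only [Set.mem_union, Set.mem_ofPred_eq, Pi.neg_apply, Finset.sum_neg_distrib, hfp,
          ← mul_neg, mul_le_mul_iff_right₀ hn0] at hω ⊢
        exact le_abs.1 hω
    _ ≤ _ := (measureReal_union_le _ _).trans (by linarith)

end Bernoulli

/-! ### All cells together: bias and concentration. -/

/-- A sum over cells of `± f log f` evaluated at relative frequencies `f` is integrable, its
expectation has a first order expansion, and it concentrates at the sub-Gaussian rate. -/
theorem plugIn_expansion_and_concentration {ι Ω : Type*} [Fintype ι] [MeasurableSpace Ω]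
    {μ : Measure Ω} [IsProbabilityMeasure μ] {n : ℕ} {b : ι → Fin n → Ω → ℝ} {p sgn : ι → ℝ}
    {r : ℝ} (hr : 0 < r) (hrp : ∀ c, r ≤ p c) (hp1 : ∀ c, p c ≤ 1) (hsgn : ∀ c, |sgn c| = 1)
    (hind : ∀ c, iIndepFun (b c) μ) (hm : ∀ c i, AEMeasurable (b c i) μ)
    (hb : ∀ c i ω, b c i ω = 0 ∨ b c i ω = 1) (hp : ∀ c i, ∫ ω, b c i ω ∂μ = p c)
    {F : Ω → ℝ}
    (hF : ∀ ω, F ω = ∑ c, sgn c * ((∑ i, b c i ω) / (n : ℝ) * Real.log ((∑ i, b c i ω) / n))) :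
    Integrable F μ ∧
    (1 ≤ n → |(∫ ω, F ω ∂μ) - ∑ c, sgn c * (p c * Real.log (p c))
      - (∑ c, sgn c * (1 - p c)) / (2 * n)|
        ≤ Fintype.card ι * (1 / r + 1 / r ^ 3) / (n : ℝ) ^ 2) ∧
    (∀ δ : ℝ, 0 < δ → δ < 1 → 1 ≤ n →
      1 - δ ≤ μ.real {ω | |F ω - ∫ ω', F ω' ∂μ| ≤ Fintype.card ι *
        ((1 / r - Real.log r) * (Fintype.card ι + 1) + 2 * (1 + (1 / r + 1 / r ^ 3))) *
          Real.sqrt (Real.log (2 / δ) / n)}) := by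
  have hF' : F = fun ω =>
      ∑ c, sgn c * ((∑ i, b c i ω) / (n : ℝ) * Real.log ((∑ i, b c i ω) / n)) := funext hF
  have hint := fun c => integrable_mean_mul_log (hm c) (hb c)
  have hFint : ∫ ω, F ω ∂μ = ∑ c, sgn c *
      ∫ ω, (∑ i, b c i ω) / (n : ℝ) * Real.log ((∑ i, b c i ω) / n) ∂μ := by
    rw [hF', integral_finsetSum _ fun c _ => (hint c).const_mul _]
    simp_rw [integral_const_mul]
  set A : ℝ := 1 / r + 1 / r ^ 3 with hA
  have hA0 : 0 ≤ A := by positivity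
  set M : ℝ := (Fintype.card ι : ℝ) with hM
  have hM0 : 0 ≤ M := Nat.cast_nonneg _
  have hbias : 1 ≤ n → |(∫ ω, F ω ∂μ) - ∑ c, sgn c * (p c * Real.log (p c))
      - (∑ c, sgn c * (1 - p c)) / (2 * n)| ≤ M * A / (n : ℝ) ^ 2 := fun hn => by
    rw [hFint, Finset.sum_div, ← Finset.sum_sub_distrib, ← Finset.sum_sub_distrib]
    refine (Finset.abs_sum_le_sum_abs _ _).trans ?_
    have : M * A / (n : ℝ) ^ 2 = ∑ _c : ι, A / (n : ℝ) ^ 2 := by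
      rw [Finset.sum_const, Finset.card_univ, nsmul_eq_mul, mul_div_assoc]
    rw [this]
    refine Finset.sum_le_sum fun c _ => ?_
    rw [mul_div_assoc, ← mul_sub, ← mul_sub, abs_mul, hsgn, one_mul]
    exact abs_integral_mean_mul_log_sub_le hr (hrp c) (hp1 c) (hind c) (hm c) (hb c) (hp c) hn
  refine ⟨?_, hbias, ?_⟩
  · rw [hF']
    exact integrable_finsetSum _ fun c _ => (hint c).const_mul _
  intro δ hδ0 hδ1 hn
  have hn0 : (0 : ℝ) < n := by exact_mod_cast hn
  have hn1 : (1 : ℝ) ≤ n := by exact_mod_cast hn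
  set L := Real.log (2 / δ) with hL
  have hL2 : 1 / 2 ≤ L := by
    have h2 : Real.log 2 ≤ L := Real.log_le_log two_pos (by rw [le_div_iff₀ hδ0]; linarith)
    linarith [Real.log_two_gt_d9]
  have hexpL : Real.exp (-L) = δ / 2 := by
    rw [hL, ← Real.log_inv, Real.exp_log (by positivity), inv_div]
  set s := Real.sqrt (L / n) with hs
  have hs0 : 0 ≤ s := Real.sqrt_nonneg _
  have hs2 : s ^ 2 = L / n := Real.sq_sqrt (by positivity)
  set K := 1 / r - Real.log r with hK
  -- Since `L ≥ 1 / 2`, the `O(1 / n)` bias is absorbed into the deviation scale `s` for every `n ≥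
  -- 1`.
  have hinv : 1 / (n : ℝ) ≤ 2 * s := by
    rw [← sq_le_sq₀ (by positivity) (by positivity), mul_pow, hs2, div_pow, one_pow,
      div_le_iff₀ (by positivity)]
    have : 2 ^ 2 * (L / n) * (n : ℝ) ^ 2 = 4 * (L * n) := by field_simp; norm_num
    nlinarith
  have hmean : |(∫ ω, F ω ∂μ) - ∑ c, sgn c * (p c * Real.log (p c))| ≤ M * (2 * (1 + A)) * s := by
    have h1 : |(∑ c, sgn c * (1 - p c)) / (2 * n)| ≤ M / n := by
      have : |∑ c, sgn c * (1 - p c)| ≤ M := by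
        refine (Finset.abs_sum_le_sum_abs _ _).trans ?_
        refine (Finset.sum_le_card_nsmul _ _ 1 fun c _ => ?_).trans (by simp [hM])
        rw [abs_mul, hsgn, one_mul, abs_le]
        constructor <;> linarith [hp1 c, hrp c]
      rw [abs_div, abs_of_pos (show (0 : ℝ) < 2 * n by positivity)]
      exact div_le_div₀ hM0 this hn0 (by linarith)
    have h2 : M * A / (n : ℝ) ^ 2 ≤ M * A / n := by
      gcongr
      nlinarith
    have h3 := hbias hn
    have h4 : M * (1 + A) * (1 / n) ≤ M * (1 + A) * (2 * s) := by gcongr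
    rw [abs_le] at h1 h3 ⊢
    have h5 : M * (1 + A) * (1 / n) = M / n + M * A / n := by ring
    constructor <;> linarith
  -- The factor `M + 1` pays for the union bound: each cell fails with probability at most `2 (δ /
  -- 2) ^ (M + 1)`, and `M ≤ 2 ^ M` makes the total at most `δ`, with a constant free of `δ`.
  let bad : ι → Set Ω := fun c => {ω | (M + 1) * s ≤ |(∑ i, b c i ω) / (n : ℝ) - p c|}
  have hbad : μ.real (⋃ c, bad c) ≤ δ := by
    have hone : ∀ c, μ.real (bad c) ≤ 2 * (δ / 2) ^ (Fintype.card ι + 1) := fun c => by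
      refine (measureReal_le_abs_mean_sub_le (hind c) (hm c) (hb c) (hp c) hn
        (by positivity)).trans ?_
      rw [← hexpL, ← Real.exp_nat_mul]
      gcongr
      rw [mul_pow, hs2]
      push_cast
      rw [← hM]
      have : 2 * (n : ℝ) * ((M + 1) ^ 2 * (L / n)) = 2 * (M + 1) ^ 2 * L := by field_simp
      rw [this]
      nlinarith [mul_nonneg hM0 hM0, mul_nonneg (mul_nonneg hM0 hM0) (by linarith : 0 ≤ L),
        mul_nonneg hM0 (by linarith : 0 ≤ L)]
    calc μ.real (⋃ c, bad c) ≤ ∑ c, μ.real (bad c) := measureReal_iUnion_fintype_le _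
      _ ≤ ∑ _c : ι, 2 * (δ / 2) ^ (Fintype.card ι + 1) := Finset.sum_le_sum fun c _ => hone c
      _ = M * (δ / 2) ^ Fintype.card ι * δ := by
        rw [Finset.sum_const, Finset.card_univ, nsmul_eq_mul, pow_succ]; ring
      _ ≤ 1 * δ := by
        gcongr
        calc M * (δ / 2) ^ Fintype.card ι ≤ 2 ^ Fintype.card ι * (1 / 2) ^ Fintype.card ι := by
              gcongr
              rw [hM]
              exact_mod_cast (Nat.lt_two_pow_self (n := Fintype.card ι)).le
          _ = 1 := by rw [← mul_pow]; norm_num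
      _ = δ := one_mul δ
  -- Covering the whole space and using subadditivity avoids complements, hence any measurability of
  -- these events.
  have hcover : (Set.univ : Set Ω) ⊆ {ω | |F ω - ∫ ω', F ω' ∂μ|
      ≤ M * (K * (M + 1) + 2 * (1 + A)) * s} ∪ ⋃ c, bad c := by
    intro ω _
    by_cases hω : ω ∈ ⋃ c, bad c
    · exact Or.inr hω
    refine Or.inl ?_
    have hdev : |F ω - ∑ c, sgn c * (p c * Real.log (p c))| ≤ M * (K * ((M + 1) * s)) := by
      rw [hF, ← Finset.sum_sub_distrib]
      refine (Finset.abs_sum_le_sum_abs _ _).trans ?_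
      refine (Finset.sum_le_card_nsmul _ _ (K * ((M + 1) * s)) fun c _ => ?_).trans (by simp [hM])
      rw [← mul_sub, abs_mul, hsgn, one_mul]
      have hI := mean_mem_Icc_of_bernoulli (hb c) ω
      refine (abs_mul_log_sub_mul_log_le hr (hrp c) (hp1 c) hI.1 hI.2).trans ?_
      have hK0 : 0 ≤ K := by
        have := Real.log_nonpos hr.le ((hrp c).trans (hp1 c))
        have : 0 < 1 / r := by positivity
        linarith
      refine mul_le_mul_of_nonneg_left ?_ hK0
      have : ω ∉ bad c := fun h => hω (Set.mem_iUnion.2 ⟨c, h⟩)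
      exact (not_le.1 this).le
    change |F ω - ∫ ω', F ω' ∂μ| ≤ _
    have htri := abs_sub_le (F ω) (∑ c, sgn c * (p c * Real.log (p c))) (∫ ω', F ω' ∂μ)
    rw [abs_sub_comm (∑ c, sgn c * (p c * Real.log (p c)))] at htri
    linarith
  have hone : (1 : ℝ) = μ.real Set.univ := by simp
  have := (measureReal_mono hcover (μ := μ)).trans (measureReal_union_le _ _)
  linarith

/-! ### Conditional mutual information as a signed sum over cells. -/

/-- If `p = 0`, both sides vanish; otherwise the marginals dominating `p` are positive and the
logarithm splits. -/
theorem mul_div_mul_log_eq {p a b m : ℝ} (hp : 0 ≤ p) (ha : p ≤ a) (hb : p ≤ b) (hm : p ≤ m) :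
    m * (p / m * Real.log (p / m / (a / m * (b / m))))
      = p * Real.log p + p * Real.log m - p * Real.log a - p * Real.log b := by
  rcases hp.eq_or_lt with rfl | hp
  · simp
  have ha := hp.trans_le ha
  have hb := hp.trans_le hb
  have hm := hp.trans_le hm
  have : p / m / (a / m * (b / m)) = p * m / (a * b) := by field_simp
  rw [this, Real.log_div (by positivity) (by positivity), Real.log_mul hp.ne' hm.ne',
    Real.log_mul ha.ne' hb.ne']
  field_simp
  ring

/-- Index set of the cells of a joint distribution and of its marginals on
`(U, Y, Z)`, `Y`, `(U, Y)` and `(Y, Z)`. -/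
abbrev CMIIndex (𝒰 𝒴 𝒵 : Type*) := ((𝒰 × 𝒴 × 𝒵) ⊕ 𝒴) ⊕ ((𝒰 × 𝒴) ⊕ (𝒴 × 𝒵))

open Classical in
/-- The set of triples that make up a marginal cell. -/
noncomputable def cmiCell {𝒰 𝒴 𝒵 : Type*} [Fintype 𝒰] [Fintype 𝒴] [Fintype 𝒵] :
    CMIIndex 𝒰 𝒴 𝒵 → Finset (𝒰 × 𝒴 × 𝒵)
  | .inl (.inl a) => {a}
  | .inl (.inr y) => Finset.univ.filter fun a => a.2.1 = y
  | .inr (.inl (u, y)) => Finset.univ.filter fun a => a.1 = u ∧ a.2.1 = y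
  | .inr (.inr (y, z)) => Finset.univ.filter fun a => a.2.1 = y ∧ a.2.2 = z

/-- The sign with which the entropy of a marginal enters conditional mutual information. -/
def cmiSign {𝒰 𝒴 𝒵 : Type*} : CMIIndex 𝒰 𝒴 𝒵 → ℝ
  | .inl _ => 1
  | .inr _ => -1

theorem abs_cmiSign {𝒰 𝒴 𝒵 : Type*} (c : CMIIndex 𝒰 𝒴 𝒵) : |cmiSign c| = 1 := by
  rcases c with c | c <;> simp [cmiSign]

section

variable {𝒰 𝒴 𝒵 : Type*} [Fintype 𝒰] [Fintype 𝒴] [Fintype 𝒵]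

theorem cmiCell_nonempty [Nonempty 𝒰] [Nonempty 𝒴] [Nonempty 𝒵] (c : CMIIndex 𝒰 𝒴 𝒵) :
    (cmiCell c).Nonempty := by
  inhabit 𝒰
  inhabit 𝒴
  inhabit 𝒵
  rcases c with (a | y) | ⟨u, y⟩ | ⟨y, z⟩
  · exact ⟨a, by simp [cmiCell]⟩
  · exact ⟨(default, y, default), by simp [cmiCell]⟩
  · exact ⟨(u, y, default), by simp [cmiCell]⟩
  · exact ⟨(default, y, z), by simp [cmiCell]⟩

/-- The mass of a marginal cell. -/
noncomputable def cmiMass (p : 𝒰 → 𝒴 → 𝒵 → ℝ) (c : CMIIndex 𝒰 𝒴 𝒵) : ℝ :=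
  ∑ a ∈ cmiCell c, p a.1 a.2.1 a.2.2

theorem cmiMass_triple (p : 𝒰 → 𝒴 → 𝒵 → ℝ) (a : 𝒰 × 𝒴 × 𝒵) :
    cmiMass p (.inl (.inl a)) = p a.1 a.2.1 a.2.2 := by
  simp [cmiMass, cmiCell]

theorem cmiMass_y (p : 𝒰 → 𝒴 → 𝒵 → ℝ) (y : 𝒴) :
    cmiMass p (.inl (.inr y)) = massY p y := by
  classical
  simp only [cmiMass, cmiCell, Finset.sum_filter, Fintype.sum_prod_type, massY]
  refine Finset.sum_congr rfl fun u _ => ?_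
  rw [Finset.sum_comm]
  simp

theorem cmiMass_uy (p : 𝒰 → 𝒴 → 𝒵 → ℝ) (u : 𝒰) (y : 𝒴) :
    cmiMass p (.inr (.inl (u, y))) = ∑ z, p u y z := by
  classical
  simp only [cmiMass, cmiCell, Finset.sum_filter, Fintype.sum_prod_type, ite_and]
  rw [Finset.sum_eq_single u (fun v _ hv => by simp [hv]) (by simp),
    Finset.sum_eq_single y (fun v _ hv => by simp [hv]) (by simp)]
  simp

theorem cmiMass_yz (p : 𝒰 → 𝒴 → 𝒵 → ℝ) (y : 𝒴) (z : 𝒵) :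
    cmiMass p (.inr (.inr (y, z))) = ∑ u, p u y z := by
  classical
  simp only [cmiMass, cmiCell, Finset.sum_filter, Fintype.sum_prod_type, ite_and]
  refine Finset.sum_congr rfl fun u _ => ?_
  rw [Finset.sum_eq_single y (fun v _ hv => by simp [hv]) (by simp)]
  simp

/-- Conditional mutual information as a signed sum of entropies of marginals. -/
theorem condMutualInfo_eq_sum (p : 𝒰 → 𝒴 → 𝒵 → ℝ) (hp : ∀ u y z, 0 ≤ p u y z) :
    condMutualInfo p = ∑ c, cmiSign c * (cmiMass p c * Real.log (cmiMass p c)) := by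
  simp only [Fintype.sum_sum_type, cmiSign, one_mul, neg_mul, Finset.sum_neg_distrib]
  rw [Fintype.sum_prod_type, Fintype.sum_prod_type (γ := ℝ) (α₁ := 𝒰) (α₂ := 𝒴),
    Fintype.sum_prod_type (γ := ℝ) (α₁ := 𝒴) (α₂ := 𝒵)]
  simp only [Fintype.sum_prod_type, cmiMass_triple, cmiMass_y, cmiMass_uy, cmiMass_yz]
  have key : condMutualInfo p = ∑ y, ∑ u, ∑ z, (p u y z * Real.log (p u y z)
      + p u y z * Real.log (massY p y) - p u y z * Real.log (∑ z, p u y z)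
      - p u y z * Real.log (∑ u, p u y z)) := by
    refine Finset.sum_congr rfl fun y _ => ?_
    rw [Finset.mul_sum]
    refine Finset.sum_congr rfl fun u _ => ?_
    rw [Finset.mul_sum]
    refine Finset.sum_congr rfl fun z _ => ?_
    simp only [condMassU, condMassZ, condMassUZ, ← Finset.sum_div]
    have h1 : p u y z ≤ ∑ z, p u y z :=
      Finset.single_le_sum (f := fun z => p u y z) (fun z _ => hp u y z) (Finset.mem_univ z)
    refine mul_div_mul_log_eq (hp u y z) h1 ?_ (h1.trans ?_)
    · exact Finset.single_le_sum (f := fun u => p u y z) (fun u _ => hp u y z) (Finset.mem_univ u)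
    · exact Finset.single_le_sum (f := fun u => ∑ z, p u y z)
        (fun u _ => Finset.sum_nonneg fun z _ => hp u y z) (Finset.mem_univ u)
  rw [key]
  -- In each of the four sums, the coordinates absent from the logarithm are summed out, turning the
  -- weight into the matching marginal.
  simp only [Finset.sum_sub_distrib, Finset.sum_add_distrib]
  have e1 : ∑ y, ∑ u, ∑ z, p u y z * Real.log (p u y z)
      = ∑ u, ∑ y, ∑ z, p u y z * Real.log (p u y z) := Finset.sum_comm
  have e2 : ∑ y, ∑ u, ∑ z, p u y z * Real.log (massY p y)
      = ∑ y, massY p y * Real.log (massY p y) := by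
    simp only [massY, ← Finset.sum_mul]
  have e3 : ∑ y, ∑ u, ∑ z, p u y z * Real.log (∑ z, p u y z)
      = ∑ u, ∑ y, (∑ z, p u y z) * Real.log (∑ z, p u y z) := by
    rw [Finset.sum_comm]
    simp only [← Finset.sum_mul]
  have e4 : ∑ y, ∑ u, ∑ z, p u y z * Real.log (∑ u, p u y z)
      = ∑ y, ∑ z, (∑ u, p u y z) * Real.log (∑ u, p u y z) := by
    refine Finset.sum_congr rfl fun y _ => ?_
    rw [Finset.sum_comm]
    simp only [← Finset.sum_mul]
  rw [e1, e2, e3, e4]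
  ring

/-- Each marginal has total mass `1`, so the masses cancel as `1 + 1 - 1 - 1` and only the signed
cell count remains. -/
theorem sum_cmiSign_mul_one_sub (p : 𝒰 → 𝒴 → 𝒵 → ℝ) (hp : ∑ u, ∑ y, ∑ z, p u y z = 1) :
    ∑ c, cmiSign c * (1 - cmiMass p c) = (Fintype.card 𝒴 : ℝ) * ((Fintype.card 𝒰 : ℝ) - 1)
      * ((Fintype.card 𝒵 : ℝ) - 1) := by
  simp only [Fintype.sum_sum_type, cmiSign, one_mul, neg_mul, Finset.sum_neg_distrib,
    Finset.sum_sub_distrib, Fintype.sum_prod_type, cmiMass_triple, cmiMass_y, cmiMass_uy,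
    cmiMass_yz, Finset.sum_const, Finset.card_univ, nsmul_eq_mul, mul_one, hp, massY]
  have e1 : ∑ y, ∑ u, ∑ z, p u y z = 1 := by rw [Finset.sum_comm, hp]
  have e2 : ∑ y, ∑ z, ∑ u, p u y z = 1 := by
    rw [← e1]
    exact Finset.sum_congr rfl fun y _ => Finset.sum_comm
  rw [e1, e2]
  simp only [Fintype.card_sum, Fintype.card_prod, Nat.cast_add, Nat.cast_mul]
  ring

open Classical in
theorem cmiMass_empiricalMass {n : ℕ} (s : Fin n → 𝒰 × 𝒴 × 𝒵) (c : CMIIndex 𝒰 𝒴 𝒵) :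
    cmiMass (empiricalMass s) c = (∑ i, if s i ∈ cmiCell c then (1 : ℝ) else 0) / n := by
  simp only [cmiMass, empiricalMass, ← Finset.sum_div, Prod.mk.eta, Finset.card_filter,
    Nat.cast_sum, Nat.cast_ite, Nat.cast_one, Nat.cast_zero]
  rw [Finset.sum_comm]
  simp

theorem cmiMass_jointMass {Ω : Type*} [MeasurableSpace Ω] (P : Measure Ω) [IsFiniteMeasure P]
    [MeasurableSpace 𝒰] [MeasurableSpace 𝒴] [MeasurableSpace 𝒵]
    [DiscreteMeasurableSpace 𝒰] [DiscreteMeasurableSpace 𝒴] [DiscreteMeasurableSpace 𝒵]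
    {U : Ω → 𝒰} {Y : Ω → 𝒴} {Z : Ω → 𝒵} (hU : Measurable U) (hY : Measurable Y)
    (hZ : Measurable Z) (c : CMIIndex 𝒰 𝒴 𝒵) :
    cmiMass (jointMass P U Y Z) c = P.real ((fun ω => (U ω, Y ω, Z ω)) ⁻¹' cmiCell c) := by
  have hX : Measurable fun ω => (U ω, Y ω, Z ω) := hU.prodMk (hY.prodMk hZ)
  rw [← sum_measureReal_preimage_singleton (cmiCell c) fun a _ => hX (measurableSet_singleton a)]
  refine Finset.sum_congr rfl fun a _ => ?_
  rw [jointMass]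
  congr 1
  ext ω
  simp [Prod.ext_iff]

end

/-! ### Lower bound on cell masses and the main theorem. -/

theorem mul_le_jointMass {𝒰 𝒴 𝒵 Ω : Type*} [MeasurableSpace Ω] (P : Measure Ω) [IsFiniteMeasure P]
    [MeasurableSpace 𝒴] [DiscreteMeasurableSpace 𝒴] {U : Ω → 𝒰} {Y : Ω → 𝒴} {Z : Ω → 𝒵}
    (hY : Measurable Y) {pmin qmin : ℝ} (hp : 0 < pmin) (hq : 0 < qmin) {u : 𝒰} {y : 𝒴} {z : 𝒵}
    (h1 : pmin ≤ P.real {ω | Y ω = y})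
    (h2 : qmin ≤ (P[|{ω | Y ω = y}]).real {ω | U ω = u ∧ Z ω = z}) :
    pmin * qmin ≤ jointMass P U Y Z u y z := by
  have hms : MeasurableSet {ω | Y ω = y} := hY (measurableSet_singleton y)
  rw [measureReal_def, cond_apply hms, ENNReal.toReal_mul, ENNReal.toReal_inv, ← measureReal_def,
    ← measureReal_def, inv_mul_eq_div, le_div_iff₀ (hp.trans_le h1)] at h2
  calc pmin * qmin ≤ qmin * P.real {ω | Y ω = y} := by nlinarith
    _ ≤ _ := h2
    _ = _ := by
      rw [jointMass]
      congr 1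
      ext ω
      simp only [Set.mem_inter_iff, Set.mem_ofPred_eq]
      tauto

theorem mainTheorem4 (KU KY KZ : ℕ) (pmin qmin : ℝ) (hpmin : 0 < pmin) (hqmin : 0 < qmin) :
    ∃ (A C : ℝ) (N₁ : ℕ) (N₂ : ℝ → ℕ),
      ∀ (𝒰 𝒴 𝒵 : Type*) [Fintype 𝒰] [Fintype 𝒴] [Fintype 𝒵]
        [MeasurableSpace 𝒰] [MeasurableSpace 𝒴] [MeasurableSpace 𝒵]
        [DiscreteMeasurableSpace 𝒰] [DiscreteMeasurableSpace 𝒴] [DiscreteMeasurableSpace 𝒵],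
      Fintype.card 𝒰 = KU → Fintype.card 𝒴 = KY → Fintype.card 𝒵 = KZ →
      -- the population
      ∀ (Ω : Type*) [MeasurableSpace Ω] (P : Measure Ω) [IsProbabilityMeasure P]
        (U : Ω → 𝒰) (Y : Ω → 𝒴) (Z : Ω → 𝒵),
      Measurable U → Measurable Y → Measurable Z →
      (∀ y, pmin ≤ P.real {ω | Y ω = y}) →
      (∀ u y z, qmin ≤ (P[|{ω | Y ω = y}]).real {ω | U ω = u ∧ Z ω = z}) →
      -- an i.i.d. sample of size `n`
      ∀ (Ω' : Type*) [MeasurableSpace Ω'] (Q : Measure Ω') [IsProbabilityMeasure Q]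
        (n : ℕ) (S : Fin n → Ω' → 𝒰 × 𝒴 × 𝒵),
      iIndepFun S Q →
      (∀ i, IdentDistrib (S i) (fun ω => (U ω, Y ω, Z ω)) Q P) →
      Integrable (fun ω => sampleCMI (fun i => S i ω)) Q ∧
      -- asymptotic bias
      (1 ≤ n →
        |(∫ ω, sampleCMI (fun i => S i ω) ∂Q) - condMutualInfo (jointMass P U Y Z)
            - (KY : ℝ) * ((KU : ℝ) - 1) * ((KZ : ℝ) - 1) / (2 * (n : ℝ))| ≤ A / (n : ℝ) ^ 2) ∧
      -- positivity of the bias for large samples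
      (2 ≤ KU → 2 ≤ KZ → N₁ ≤ n →
        condMutualInfo (jointMass P U Y Z) < ∫ ω, sampleCMI (fun i => S i ω) ∂Q) ∧
      -- concentration
      (∀ δ : ℝ, 0 < δ → δ < 1 → N₂ δ ≤ n →
        1 - δ ≤ Q.real {ω | |sampleCMI (fun i => S i ω) - ∫ ω', sampleCMI (fun i => S i ω') ∂Q|
          ≤ C * Real.sqrt (Real.log (2 / δ) / (n : ℝ))}) := by
  classical
  set r := pmin * qmin with hrdef
  have hr : 0 < r := mul_pos hpmin hqmin
  set M : ℝ := ((KU * (KY * KZ) + KY + (KU * KY + KY * KZ) : ℕ) : ℝ) with hMdef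
  set A : ℝ := M * (1 / r + 1 / r ^ 3) with hAdef
  have hA : 0 ≤ A := by positivity
  -- `M` is the number of cells. The choice of `N₁` forces `n > 2A`, so the error `A / n²` is below
  -- `1 / (2n)`, itself at most the main bias term. Concentration already holds from `n = 1`,
  -- whatever `δ`.
  refine ⟨A, M * ((1 / r - Real.log r) * (M + 1) + 2 * (1 + (1 / r + 1 / r ^ 3))),
    ⌊2 * A⌋₊ + 1, fun _ => 1, ?_⟩
  intro 𝒰 𝒴 𝒵 _ _ _ _ _ _ _ _ _ hKU hKY hKZ Ω _ P _ U Y Z hU hY hZ hpY hqUZ Ω' _ Q _ n S hS hid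
  have hM : M = Fintype.card (CMIIndex 𝒰 𝒴 𝒵) := by
    simp only [hMdef, Fintype.card_sum, Fintype.card_prod, hKU, hKY, hKZ]
  obtain ⟨ω₀⟩ : Nonempty Ω := nonempty_of_isProbabilityMeasure P
  have : Nonempty 𝒰 := ⟨U ω₀⟩
  have : Nonempty 𝒴 := ⟨Y ω₀⟩
  have : Nonempty 𝒵 := ⟨Z ω₀⟩
  have hX : Measurable fun ω => (U ω, Y ω, Z ω) := hU.prodMk (hY.prodMk hZ)
  set p := jointMass P U Y Z with hpdef
  have hp0 : ∀ u y z, 0 ≤ p u y z := fun _ _ _ => measureReal_nonneg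
  have hmass := cmiMass_jointMass P hU hY hZ
  -- Every cell contains a triple, and each triple has mass at least `pmin * qmin`.
  have hrp : ∀ c, r ≤ cmiMass p c := fun c => by
    obtain ⟨a, ha⟩ := cmiCell_nonempty c
    exact (mul_le_jointMass P hY hpmin hqmin (hpY a.2.1) (hqUZ a.1 a.2.1 a.2.2)).trans
      (Finset.single_le_sum (f := fun a => p a.1 a.2.1 a.2.2) (fun a _ => hp0 _ _ _) ha)
  have hp1 : ∀ c, cmiMass p c ≤ 1 := fun c => by
    rw [hmass]
    exact measureReal_le_one
  have hsum : ∑ u, ∑ y, ∑ z, p u y z = 1 := by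
    have h := sum_measureReal_preimage_singleton (μ := P) Finset.univ
      (f := fun ω => (U ω, Y ω, Z ω)) fun a _ => hX (measurableSet_singleton a)
    simp only [Finset.coe_univ, Set.preimage_univ, probReal_univ, Fintype.sum_prod_type] at h
    rw [← h]
    refine Finset.sum_congr rfl fun u _ => Finset.sum_congr rfl fun y _ =>
      Finset.sum_congr rfl fun z _ => ?_
    rw [hpdef, jointMass]
    congr 1
    ext ω
    simp [Prod.ext_iff]
  -- Cell indicators, whose values along the sample are the Bernoulli variables.
  let g : CMIIndex 𝒰 𝒴 𝒵 → 𝒰 × 𝒴 × 𝒵 → ℝ := fun c a => if a ∈ cmiCell c then 1 else 0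
  have hg : ∀ c, Measurable (g c) := fun c => Measurable.of_discrete
  have hmean : ∀ c i, ∫ ω, g c (S i ω) ∂Q = cmiMass p c := fun c i => by
    refine (((hid i).comp (hg c)).integral_eq).trans ?_
    rw [hmass, ← integral_indicator_one (hX (cmiCell c).measurableSet)]
    refine integral_congr_ae (ae_of_all _ fun ω => ?_)
    simp [g, Set.indicator_apply]
  obtain ⟨h1, h2, h3⟩ := plugIn_expansion_and_concentration (μ := Q)
    (b := fun c i ω => g c (S i ω)) (F := fun ω => sampleCMI fun i => S i ω)
    hr hrp hp1 abs_cmiSign (fun c => hS.comp (fun _ => g c) fun _ => hg c)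
    (fun c i => (hg c).comp_aemeasurable (hid i).aemeasurable_fst)
    (fun c i ω => (ite_eq_or_eq _ _ _).symm) hmean
    (fun ω => by
      rw [sampleCMI, condMutualInfo_eq_sum _ fun _ _ _ => by unfold empiricalMass; positivity]
      simp only [cmiMass_empiricalMass, g])
  rw [← condMutualInfo_eq_sum p hp0, sum_cmiSign_mul_one_sub p hsum, hKU, hKY, hKZ, ← hM,
    ← hAdef] at h2
  rw [← hM] at h3
  refine ⟨h1, h2, fun hU2 hZ2 hn => ?_, h3⟩
  have hnA : 2 * A < n := (Nat.lt_floor_add_one _).trans_le (by exact_mod_cast hn)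
  have hn1 : 1 ≤ n := by omega
  have hn0 : (0 : ℝ) < n := by exact_mod_cast hn1
  have hK : (1 : ℝ) ≤ (KY : ℝ) * ((KU : ℝ) - 1) * ((KZ : ℝ) - 1) := by
    have hY1 : (1 : ℝ) ≤ KY := by exact_mod_cast hKY ▸ Fintype.card_pos
    have hU1 : (2 : ℝ) ≤ KU := by exact_mod_cast hU2
    have hZ1 : (2 : ℝ) ≤ KZ := by exact_mod_cast hZ2
    exact one_le_mul_of_one_le_of_one_le (one_le_mul_of_one_le_of_one_le hY1 (by linarith))
      (by linarith)
  have hlt : A / (n : ℝ) ^ 2 < (KY : ℝ) * ((KU : ℝ) - 1) * ((KZ : ℝ) - 1) / (2 * n) := by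
    rw [div_lt_div_iff₀ (by positivity) (by positivity)]
    nlinarith [mul_pos hn0 (sub_pos.2 hnA), mul_nonneg (sub_nonneg.2 hK) (sq_nonneg (n : ℝ))]
  linarith [(abs_le.1 (h2 hn1)).1]
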